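/- An operator system is a norm-closed subspace $E \subseteq B(H)$ ($H$ a complex Hilbert space) with $x^* \in E$ for all $x \in E$; $M_n(E)$ carries the norm and the positive cone $M_n(E)_+$ inherited from the C*-algebra $M_n(B(H))$, and $E_+ = M_1(E)_+$. We say that $E$ is isomorphic to a (not necessarily unital) C*-algebra $A$ if there is a $*$-preserving linear bijection $E \to A$ that is completely isometric and a complete order isomorphism. The canonical unitization $E^\sharp$ is the $*$-vector space $E \oplus \mathbb{C}$ with $(x,a)^* = (x^*, \overline{a})$, unit $(0,1)$ and the following matrix order: $(x,A) \in M_n(E) \oplus M_n(\mathbb{C}) = M_n(E^\sharp)$ is positive iff it is self-adjoint, $A \ge 0$, and $\varphi\big((A+\varepsilon)^{-1/2}\, x\, (A+\varepsilon)^{-1/2}\big) \ge -1$ for all $\varepsilon > 0$ and all quasi-states $\varphi$ of $M_n(E)$, that is, all positive contractive self-adjoint linear functionals $\varphi : M_n(E) \to \mathbb{C}$. We say that $E^\sharp$ is isomorphic to a unital C*-algebra $B$ if there is a $*$-preserving unital complete order isomorphism $E^\sharp \to B$. The zero map $\delta_0 : E \to \mathbb{C}$ has the unital extension $\delta_0^\sharp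 : E^\sharp \to \mathbb{C}$, $(x,a) \mapsto a$; given an isomorphism $\Phi$ from $E^\sharp$ onto a C*-algebra $B$, we say that the zero map is a $*$-homomorphism with respect to $\Phi$ if $\delta_0^\sharp \circ \Phi^{-1} : B \to \mathbb{C}$ is a $*$-homomorphism. **Corollary.** Let $E$ be an operator system. The following are equivalent: 1. $E$ is isomorphic to a C*-algebra. 2. $E^\sharp$ is isomorphic to a C*-algebra and $E$ is generated by positives, that is, $\operatorname{span}(E_+) = E$. 3. $E^\sharp$ is isomorphic to a C*-algebra and $E$ is approximately generated by positives, that is, $\overline{\operatorname{span}}(E_+) = E$. 4. $E^\sharp$ is isomorphic to a C*-algebra and the zero map is a $*$-homomorphism with respect to some isomorphism of $E^\sharp$ onto a C*-algebra. 5. $E^\sharp$ is isomorphic to a C*-algebra and the zero map is a $*$-homomorphism with respect to every isomorphism of $E^\sharp$ onto a C*-algebra. -/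

import Mathlib

open scoped ComplexOrder

universe u

/-- A (possibly non-unital) operator system: a norm-closed subspace of `B(H)` that is closed under
the involution. -/
structure OperatorSystem (H : Type*) [NormedAddCommGroup H] [InnerProductSpace ℂ H]
    [CompleteSpace H] extends Submodule ℂ (H →L[ℂ] H) where
  star_mem' : ∀ x ∈ carrier, star x ∈ carrier
  isClosed' : IsClosed carrier

namespace OperatorSystem

section

variable {H : Type*} [NormedAddCommGroup H] [InnerProductSpace ℂ H] [CompleteSpace H]

noncomputable instance instStar (E : OperatorSystem H) : Star E.toSubmodule where
  star x := ⟨star (x : H →L[ℂ] H), E.star_mem' x x.2⟩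

/-- The inclusion `M_n(E) ⊆ M_n(B(H))`, the latter with its C⋆-algebra structure. -/
def toCStarMatrix (E : OperatorSystem H) {n : ℕ} (X : Matrix (Fin n) (Fin n) E.toSubmodule) :
    CStarMatrix (Fin n) (Fin n) (H →L[ℂ] H) :=
  CStarMatrix.ofMatrix (X.map fun x => (x : H →L[ℂ] H))

/-- The cone `M_n(E)₊`, inherited from the C⋆-algebra `M_n(B(H))`. -/
def MatPos (E : OperatorSystem H) {n : ℕ} (X : Matrix (Fin n) (Fin n) E.toSubmodule) : Prop :=
  0 ≤ E.toCStarMatrix X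

/-- The norm of `M_n(E)`, inherited from the C⋆-algebra `M_n(B(H))`. -/
noncomputable def matNorm (E : OperatorSystem H) {n : ℕ}
    (X : Matrix (Fin n) (Fin n) E.toSubmodule) : ℝ :=
  ‖E.toCStarMatrix X‖

/-- Isomorphisms of the operator system `E` with a C⋆-algebra `A`: completely isometric complete
order isomorphisms, that is, linear `⋆`-preserving bijections all of whose matrix amplifications
are isometric and preserve positivity in both directions. -/
structure CStarIso (E : OperatorSystem H) (A : Type*) [NonUnitalCStarAlgebra A] [PartialOrder A]
    [StarOrderedRing A] extends E.toSubmodule ≃ₗ[ℂ] A where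
  map_star' : ∀ x, toFun (star x) = star (toFun x)
  map_pos_iff' : ∀ (n : ℕ) (X : Matrix (Fin n) (Fin n) E.toSubmodule),
    0 ≤ CStarMatrix.ofMatrix (X.map toFun) ↔ E.MatPos X
  norm_map' : ∀ (n : ℕ) (X : Matrix (Fin n) (Fin n) E.toSubmodule),
    ‖CStarMatrix.ofMatrix (X.map toFun)‖ = E.matNorm X

/-- The set `E₊` of positive elements of `E`, as a subset of `B(H)`. -/
def posElements (E : OperatorSystem H) : Set (H →L[ℂ] H) :=
  {x | x ∈ E.toSubmodule ∧ 0 ≤ x}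

/-- `E` is generated by positives: `span E₊ = E`. -/
def GeneratedByPositives (E : OperatorSystem H) : Prop :=
  Submodule.span ℂ E.posElements = E.toSubmodule

/-- `E` is approximately generated by positives: the span of `E₊` is norm-dense in `E`. -/
def ApproxGeneratedByPositives (E : OperatorSystem H) : Prop :=
  (Submodule.span ℂ E.posElements).topologicalClosure = E.toSubmodule

/-- Quasi-states of `M_n(E)`: positive contractive (self-adjoint) linear functionals. -/
structure IsQuasiState (E : OperatorSystem H) {n : ℕ}
    (φ : Matrix (Fin n) (Fin n) E.toSubmodule →ₗ[ℂ] ℂ) : Prop where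
  map_star : ∀ X, φ X.conjTranspose = star (φ X)
  nonneg : ∀ X, E.MatPos X → 0 ≤ φ X
  norm_le : ∀ X, ‖φ X‖ ≤ E.matNorm X

/-- The product `C X C ∈ M_n(E)` for `C ∈ M_n(ℂ)` and `X ∈ M_n(E)`. -/
def scalarMulMul (E : OperatorSystem H) {n : ℕ} (C : Matrix (Fin n) (Fin n) ℂ)
    (X : Matrix (Fin n) (Fin n) E.toSubmodule) : Matrix (Fin n) (Fin n) E.toSubmodule :=
  fun i j => ∑ k, ∑ l, (C i k * C l j) • X k l

/-- `A ^ (-1/2)` for a positive definite complex matrix `A`, by functional calculus. -/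
noncomputable def invSqrt {n : ℕ} (A : Matrix (Fin n) (Fin n) ℂ) : Matrix (Fin n) (Fin n) ℂ :=
  cfc (fun t : ℝ => (Real.sqrt t)⁻¹) A

/-- The vector space `E ⊕ ℂ` underlying the canonical unitization `E^♯`. Its involution is
`(x, a)⋆ = (x⋆, conj a)` and its unit is `(0, 1)`. -/
abbrev Sharp (E : OperatorSystem H) := E.toSubmodule × ℂ

/-- The matrix order of the canonical unitization `E^♯`: `(x, A) ∈ M_n(E) ⊕ M_n(ℂ) = M_n(E^♯)` is
positive iff it is self-adjoint, `A ≥ 0`, and `φ((A + ε)^(-1/2) x (A + ε)^(-1/2)) ≥ -1` for all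
`ε > 0` and all quasi-states `φ` of `M_n(E)`. (These values of `φ` are real.) -/
def SharpMatPos (E : OperatorSystem H) {n : ℕ} (X : Matrix (Fin n) (Fin n) E.Sharp) : Prop :=
  X.IsHermitian ∧ (X.map Prod.snd).PosSemidef ∧
    ∀ ε : ℝ, 0 < ε → ∀ φ : Matrix (Fin n) (Fin n) E.toSubmodule →ₗ[ℂ] ℂ, E.IsQuasiState φ →
      -1 ≤ (φ (E.scalarMulMul (invSqrt (X.map Prod.snd + (ε : ℂ) • 1)) (X.map Prod.fst))).re

/-- Isomorphisms of the unital operator system `E^♯` with a unital C⋆-algebra `B`: unital complete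
order isomorphisms. -/
structure SharpCStarIso (E : OperatorSystem H) (B : Type*) [CStarAlgebra B] [PartialOrder B]
    [StarOrderedRing B] extends E.Sharp ≃ₗ[ℂ] B where
  map_one' : toFun (0, 1) = 1
  map_star' : ∀ v, toFun (star v) = star (toFun v)
  map_pos_iff' : ∀ (n : ℕ) (X : Matrix (Fin n) (Fin n) E.Sharp),
    0 ≤ CStarMatrix.ofMatrix (X.map toFun) ↔ E.SharpMatPos X

/-- The unital extension `f^♯ : E^♯ → ℂ`, `(x, a) ↦ f x + a`, of `f : E → ℂ`. -/
def sharpExtension (E : OperatorSystem H) (f : E.toSubmodule →ₗ[ℂ] ℂ) : E.Sharp →ₗ[ℂ] ℂ :=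
  f.coprod LinearMap.id

/-- With `E^♯` identified with the C⋆-algebra `B` through `Φ`, the zero map of `E` is (that is, its
unital extension to `E^♯` is) a `⋆`-homomorphism. -/
def ZeroMapIsStarHom (E : OperatorSystem H) {B : Type*} [CStarAlgebra B] [PartialOrder B]
    [StarOrderedRing B] (Φ : E.SharpCStarIso B) : Prop :=
  ∃ χ : B →⋆ₐ[ℂ] ℂ, ∀ v : E.Sharp, χ (Φ.toLinearEquiv v) = E.sharpExtension 0 v

end

section

variable {H : Type u} [NormedAddCommGroup H] [InnerProductSpace ℂ H] [CompleteSpace H]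

/-- `E` is isomorphic to a C⋆-algebra. -/
def IsCStar (E : OperatorSystem H) : Prop :=
  ∃ (A : Type u) (_ : NonUnitalCStarAlgebra A) (_ : PartialOrder A) (_ : StarOrderedRing A),
    Nonempty (E.CStarIso A)

/-- `E^♯` is isomorphic to a C⋆-algebra. -/
def SharpIsCStar (E : OperatorSystem H) : Prop :=
  ∃ (B : Type u) (_ : CStarAlgebra B) (_ : PartialOrder B) (_ : StarOrderedRing B),
    Nonempty (E.SharpCStarIso B)

end

end OperatorSystem

/-! Two facts carry the equivalence.

Passing from `E^♯` down to `E`. The matrix order of `E^♯` remembers both the cones and the norms of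
`E`: `(x, 0) ≥ 0` means `x ≥ 0`, and `‖x‖ ≤ 1` means that the matrix with diagonal blocks `1` and
off-diagonal blocks `x`, `x⋆` is positive. Hence any isomorphism of `E^♯` with a C⋆-algebra `B`
embeds `E` completely isometrically and completely order-isomorphically in `B`, as the kernel of the
positive unital functional `ω (x, a) = a`. If `ω` is multiplicative, this kernel is a C⋆-algebra.
Conversely, if the positive elements of `E` span a dense subspace, Cauchy–Schwarz for `ω` gives `ω
(b x) = 0` for all `b ∈ B` and `x ∈ E`, and since `B = E + ℂ1`, `ω` is multiplicative.

Passing from `E ≅ A` up to `E^♯`. The candidate is the C⋆-unitization of `A`, and its order must be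
matched with the one defined by quasi-states. Conjugation by `(a + ε)^(-1/2)` reduces this to `z + 1
≥ 0` for self-adjoint `z = p - q` (positive and negative parts in `M_n(A)`), which means `‖q‖ ≤ 1`.
Vector functionals of `H ^ n` are quasi-states, so the quasi-state condition gives `p - q + 1 ≥ 0`
in `M_n(B(H))`. There `p` and `q` need not be orthogonal, as `E ≅ A` respects only norm and order;
but `‖t p + q‖ ≤ ‖q‖` for some `t > 0` survives, and together with `p - q + 1 ≥ 0` it forces `‖q‖ ≤
1`. -/

set_option linter.unusedSectionVars false

/-! ### Injective `⋆`-homomorphisms reflect positivity -/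

namespace NonUnitalStarAlgHom

variable {A B : Type*} [NonUnitalCStarAlgebra A] [NonUnitalCStarAlgebra B]

open scoped CStarAlgebra in
lemma map_negPart (φ : A →⋆ₙₐ[ℂ] B) {a : A} (ha : IsSelfAdjoint a) : φ a⁻ = (φ a)⁻ :=
  NonUnitalStarAlgHom.map_cfcₙ φ (·⁻ : ℝ → ℝ) a (hφa := ha.map φ)

lemma nonneg_of_map_nonneg [PartialOrder A] [StarOrderedRing A] [PartialOrder B]
    [StarOrderedRing B] (φ : A →⋆ₙₐ[ℂ] B) (hφ : Function.Injective φ) {a : A} (h : 0 ≤ φ a) :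
    0 ≤ a := by
  have ha : IsSelfAdjoint a := hφ (by rw [map_star]; exact (IsSelfAdjoint.of_nonneg h).star_eq)
  rw [← CFC.negPart_eq_zero_iff a ha]
  apply hφ
  rw [map_negPart φ ha, map_zero]
  exact (CFC.negPart_eq_zero_iff (φ a) (.of_nonneg h)).2 h

lemma map_nonneg_iff [PartialOrder A] [StarOrderedRing A] [PartialOrder B]
    [StarOrderedRing B] (φ : A →⋆ₙₐ[ℂ] B) (hφ : Function.Injective φ) {a : A} :
    0 ≤ φ a ↔ 0 ≤ a :=
  ⟨φ.nonneg_of_map_nonneg hφ, fun h => map_nonneg φ h⟩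

end NonUnitalStarAlgHom

/-! ### Matrices over C⋆-algebras, block matrices -/

namespace CStarMatrix

section

variable {A : Type*} [NonUnitalCStarAlgebra A] [PartialOrder A] [StarOrderedRing A]

lemma mapₙₐ_injective {n B : Type*} [Fintype n] [NonUnitalCStarAlgebra B]
    {f : A →⋆ₙₐ[ℂ] B} (hf : Function.Injective f) :
    Function.Injective (mapₙₐ (n := n) f) := by
  intro M N h
  ext i j
  exact hf (congrFun (congrFun h i) j)

/-- The identification of `A` with the `1 × 1` matrices over `A`. -/
def constHom (n A : Type*) [Fintype n] [Unique n] [NonUnitalCStarAlgebra A] :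
    A →⋆ₙₐ[ℂ] CStarMatrix n n A where
  toFun a := ofMatrix fun _ _ => a
  map_smul' _ _ := rfl
  map_zero' := rfl
  map_add' _ _ := rfl
  map_mul' _ _ := by ext; simp [mul_apply]; rfl
  map_star' _ := rfl

lemma ofMatrix_const_nonneg_iff {n : Type*} [Fintype n] [Unique n] {a : A} :
    0 ≤ (ofMatrix fun _ _ => a : CStarMatrix n n A) ↔ 0 ≤ a :=
  (constHom n A).map_nonneg_iff fun _ _ h => congrFun (congrFun h default) default

lemma norm_ofMatrix_const {n : Type*} [Fintype n] [Unique n] (a : A) :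
    ‖(ofMatrix fun _ _ => a : CStarMatrix n n A)‖ = ‖a‖ :=
  NonUnitalStarAlgHom.norm_map (B := CStarMatrix n n A) (constHom n A)
    (fun _ _ h => congrFun (congrFun h default) default) a

end

section

variable {A : Type*} [CStarAlgebra A] [PartialOrder A] [StarOrderedRing A]
  {n : Type*} [Fintype n] [DecidableEq n]

lemma exists_eq_star_mul_self_of_nonneg {B : Type*} [NonUnitalCStarAlgebra B] [PartialOrder B]
    [StarOrderedRing B] {b : B} (hb : 0 ≤ b) : ∃ s, b = star s * s :=
  CStarAlgebra.nonneg_iff_eq_star_mul_self.1 hb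

lemma norm_le_one_iff_mul_star_le {B : Type*} [CStarAlgebra B] [PartialOrder B]
    [StarOrderedRing B] {b : B} : ‖b‖ ≤ 1 ↔ 0 ≤ 1 - b * star b := by
  rw [sub_nonneg, ← CStarAlgebra.norm_le_one_iff_of_nonneg (b * star b) (mul_star_self_nonneg b),
    CStarRing.norm_self_mul_star, ← sq, sq_le_one_iff₀ (norm_nonneg b)]

/-- Assemble a block matrix. -/
def blocks (a b c d : CStarMatrix n n A) : CStarMatrix (n ⊕ n) (n ⊕ n) A :=
  ofMatrix (Matrix.fromBlocks a b c d)

lemma blocks_mul (a b c d a' b' c' d' : CStarMatrix n n A) :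
    blocks a b c d * blocks a' b' c' d' =
      blocks (a * a' + b * c') (a * b' + b * d') (c * a' + d * c') (c * b' + d * d') :=
  Matrix.fromBlocks_multiply _ _ _ _ _ _ _ _

lemma star_blocks (a b c d : CStarMatrix n n A) :
    star (blocks a b c d) = blocks (star a) (star c) (star b) (star d) :=
  Matrix.fromBlocks_conjTranspose _ _ _ _

lemma exists_blocks (M : CStarMatrix (n ⊕ n) (n ⊕ n) A) : ∃ a b c d, M = blocks a b c d :=
  ⟨_, _, _, _, (Matrix.fromBlocks_toBlocks (ofMatrix.symm M)).symm⟩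

lemma blocks_inj {a b c d a' b' c' d' : CStarMatrix n n A} :
    blocks a b c d = blocks a' b' c' d' ↔ a = a' ∧ b = b' ∧ c = c' ∧ d = d' :=
  Matrix.fromBlocks_inj

lemma one_eq_blocks : (1 : CStarMatrix (n ⊕ n) (n ⊕ n) A) = blocks 1 0 0 1 :=
  Matrix.fromBlocks_one.symm

lemma blocks_add (a b c d a' b' c' d' : CStarMatrix n n A) :
    blocks a b c d + blocks a' b' c' d' = blocks (a + a') (b + b') (c + c') (d + d') :=
  Matrix.fromBlocks_add _ _ _ _ _ _ _ _

lemma neg_blocks (a b c d : CStarMatrix n n A) :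
    -blocks a b c d = blocks (-a) (-b) (-c) (-d) :=
  Matrix.fromBlocks_neg _ _ _ _

lemma blocks_zero_zero_nonneg_iff {a d : CStarMatrix n n A} :
    0 ≤ blocks a 0 0 d ↔ 0 ≤ a ∧ 0 ≤ d := by
  refine ⟨fun h => ?_, fun ⟨ha, hd⟩ => ?_⟩
  · obtain ⟨s, hs⟩ := exists_eq_star_mul_self_of_nonneg h
    obtain ⟨p, q, r, t, rfl⟩ := exists_blocks s
    rw [star_blocks, blocks_mul, blocks_inj] at hs
    obtain ⟨h1, -, -, h2⟩ := hs
    exact ⟨h1 ▸ add_nonneg (star_mul_self_nonneg _) (star_mul_self_nonneg _),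
      h2 ▸ add_nonneg (star_mul_self_nonneg _) (star_mul_self_nonneg _)⟩
  · obtain ⟨s, rfl⟩ := exists_eq_star_mul_self_of_nonneg ha
    obtain ⟨t, rfl⟩ := exists_eq_star_mul_self_of_nonneg hd
    have : blocks (star s * s) 0 0 (star t * t) = star (blocks s 0 0 t) * blocks s 0 0 t := by
      simp [star_blocks, blocks_mul]
    rw [this]
    exact star_mul_self_nonneg _

/-- Schur complement: conjugation by an invertible triangular matrix turns the block matrix into
`diag(1 - x x⋆, 1)`. This expresses the norm through the order one matrix level up. -/
lemma norm_le_one_iff_blocks_nonneg {x : CStarMatrix n n A} :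
    ‖x‖ ≤ 1 ↔ 0 ≤ blocks 1 x (star x) 1 := by
  have h1 : blocks 1 x (star x) 1 =
      star (blocks 1 0 (star x) 1) * blocks (1 - x * star x) 0 0 1 * blocks 1 0 (star x) 1 := by
    simp [star_blocks, blocks_mul]
  have h2 : blocks (1 - x * star x) 0 0 1 =
      star (blocks 1 0 (-star x) 1) * blocks 1 x (star x) 1 * blocks 1 0 (-star x) 1 := by
    simp [star_blocks, blocks_mul, sub_eq_add_neg]
  rw [norm_le_one_iff_mul_star_le]
  refine ⟨fun h => ?_, fun h => ?_⟩
  · rw [h1]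
    exact star_left_conjugate_nonneg (blocks_zero_zero_nonneg_iff.2 ⟨h, zero_le_one⟩) _
  · refine (blocks_zero_zero_nonneg_iff (d := 1).1 ?_).1
    rw [h2]
    exact star_left_conjugate_nonneg h _

lemma norm_offDiag_le_one {x : CStarMatrix n n A} (h : ‖x‖ ≤ 1) :
    ‖blocks 0 x (star x) 0‖ ≤ 1 := by
  rw [norm_le_one_iff_mul_star_le]
  have : 1 - blocks 0 x (star x) 0 * star (blocks 0 x (star x) 0) =
      blocks (1 - x * star x) 0 0 (1 - star x * star (star x)) := by
    simp [star_blocks, blocks_mul, one_eq_blocks, sub_eq_add_neg, neg_blocks, blocks_add]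
  rw [this, blocks_zero_zero_nonneg_iff]
  exact ⟨norm_le_one_iff_mul_star_le.1 h, norm_le_one_iff_mul_star_le.1 (by rwa [norm_star])⟩

end

/-! ### The representation of `M_n(B(H))` on `H ^ n` -/

section Operators

variable {H : Type*} [NormedAddCommGroup H] [InnerProductSpace ℂ H] [CompleteSpace H]
  {n : Type*} [Fintype n] [DecidableEq n]

open ContinuousLinearMap

/-- The inclusion of the `i`-th summand of `H ^ n`. -/
noncomputable def summandIncl (H : Type*) [NormedAddCommGroup H] [InnerProductSpace ℂ H]
    [CompleteSpace H] (i : n) : H →L[ℂ] PiLp 2 (fun _ : n => H) :=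
  adjoint (PiLp.proj 2 (fun _ : n => H) i)

lemma summandIncl_apply (i j : n) (x : H) :
    (summandIncl H j x : PiLp 2 (fun _ : n => H)) i = if i = j then x else 0 := by
  have : (summandIncl H j x : PiLp 2 (fun _ : n => H)) =
      WithLp.toLp 2 (fun i => if i = j then x else 0) := by
    refine ext_inner_right ℂ fun y => ?_
    rw [summandIncl, adjoint_inner_left, PiLp.inner_apply, Finset.sum_eq_single j]
    · simp
    · intro b _ hb
      simp [hb]
    · simp
  rw [this]

/-- The operator on `H ^ n` given by a matrix of operators on `H`. -/
noncomputable def toOperatorAux (M : CStarMatrix n n (H →L[ℂ] H)) :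
    PiLp 2 (fun _ : n => H) →L[ℂ] PiLp 2 (fun _ : n => H) :=
  ∑ i, ∑ j, summandIncl H i ∘L M i j ∘L PiLp.proj 2 (fun _ : n => H) j

lemma toOperatorAux_apply (M : CStarMatrix n n (H →L[ℂ] H)) (v : PiLp 2 (fun _ : n => H))
    (i : n) : (toOperatorAux M v) i = ∑ j, M i j (v j) := by
  simp only [toOperatorAux, sum_apply, WithLp.ofLp_sum, Finset.sum_apply, comp_apply,
    PiLp.proj_apply, summandIncl_apply]
  rw [Finset.sum_eq_single i] <;> simp +contextual [eq_comm]

/-- The action of `M_n(B(H))` on `H ^ n`, as a `⋆`-homomorphism. -/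
noncomputable def toOperator (H n : Type*) [NormedAddCommGroup H] [InnerProductSpace ℂ H]
    [CompleteSpace H] [Fintype n] [DecidableEq n] :
    CStarMatrix n n (H →L[ℂ] H) →⋆ₙₐ[ℂ]
      (PiLp 2 (fun _ : n => H) →L[ℂ] PiLp 2 (fun _ : n => H)) where
  toFun := toOperatorAux
  map_smul' c M := by
    ext v i
    simp [toOperatorAux_apply, Finset.smul_sum]
  map_zero' := by
    ext v i
    simp [toOperatorAux_apply]
  map_add' M N := by
    ext v i
    simp [toOperatorAux_apply, Finset.sum_add_distrib]
  map_mul' M N := by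
    ext v i
    simp only [toOperatorAux_apply, mul_apply, sum_apply, mul_apply_eq_comp, map_sum]
    exact Finset.sum_comm
  map_star' M := by
    rw [ContinuousLinearMap.star_eq_adjoint, eq_adjoint_iff]
    intro v w
    simp only [PiLp.inner_apply, toOperatorAux_apply, sum_inner, inner_sum, star_apply,
      ContinuousLinearMap.star_eq_adjoint, adjoint_inner_left]
    exact Finset.sum_comm

lemma toOperator_apply (M : CStarMatrix n n (H →L[ℂ] H)) (v : PiLp 2 (fun _ : n => H)) (i : n) :
    (toOperator H n M v) i = ∑ j, M i j (v j) :=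
  toOperatorAux_apply M v i

/-- Makes the representation isometric and order-reflecting, so that norm and order of `M_n(B(H))`
can be tested on vectors. -/
lemma toOperator_injective : Function.Injective (toOperator H n) := by
  intro M N h
  ext i j x
  have := congrArg (fun T => (T (summandIncl H j x) : PiLp 2 (fun _ : n => H)) i) h
  simpa only [toOperator_apply, summandIncl_apply, apply_ite, map_zero, Finset.sum_ite_eq',
    Finset.sum_ite_eq, Finset.mem_univ, if_true] using this

end Operators
end CStarMatrix

namespace CStarMatrix

variable {A : Type*} [CStarAlgebra A] [PartialOrder A] [StarOrderedRing A]
  {m n : Type*} [Fintype n] [DecidableEq n] [Fintype m] [DecidableEq m]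

lemma reindexₐ_nonneg_iff (e : m ≃ n) {M : CStarMatrix m m A} :
    0 ≤ reindexₐ ℂ A e M ↔ 0 ≤ M :=
  ((reindexₐ ℂ A e : CStarMatrix m m A ≃⋆ₐ[ℂ] CStarMatrix n n A) :
    CStarMatrix m m A →⋆ₙₐ[ℂ] CStarMatrix n n A).map_nonneg_iff (reindexₐ ℂ A e).injective

lemma norm_reindexₐ (e : m ≃ n) (M : CStarMatrix m m A) :
    ‖reindexₐ ℂ A e M‖ = ‖M‖ :=
  NonUnitalStarAlgHom.norm_map (reindexₐ ℂ A e) (reindexₐ ℂ A e).injective M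

lemma reindexₐ_one (e : m ≃ n) : reindexₐ ℂ A e 1 = 1 := map_one _

end CStarMatrix

/-! ### Vector functionals as quasi-states -/

namespace OperatorSystem

variable {H : Type*} [NormedAddCommGroup H] [InnerProductSpace ℂ H] [CompleteSpace H]
  (E : OperatorSystem H) {n : ℕ}

open CStarMatrix

lemma toCStarMatrix_add (X Y : Matrix (Fin n) (Fin n) E.toSubmodule) :
    E.toCStarMatrix (X + Y) = E.toCStarMatrix X + E.toCStarMatrix Y := rfl

lemma toCStarMatrix_smul (c : ℂ) (X : Matrix (Fin n) (Fin n) E.toSubmodule) :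
    E.toCStarMatrix (c • X) = c • E.toCStarMatrix X := rfl

lemma toCStarMatrix_conjTranspose (X : Matrix (Fin n) (Fin n) E.toSubmodule) :
    E.toCStarMatrix X.conjTranspose = star (E.toCStarMatrix X) := rfl

lemma toCStarMatrix_injective :
    Function.Injective (E.toCStarMatrix : Matrix (Fin n) (Fin n) E.toSubmodule → _) := by
  intro X Y h
  ext i j : 2
  exact congrFun (congrFun h i) j

lemma isSelfAdjoint_toCStarMatrix_iff {X : Matrix (Fin n) (Fin n) E.toSubmodule} :
    IsSelfAdjoint (E.toCStarMatrix X) ↔ X.IsHermitian := by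
  rw [isSelfAdjoint_iff, ← toCStarMatrix_conjTranspose, E.toCStarMatrix_injective.eq_iff]
  rfl

/-- The functional on `M_n(E)` given by a vector of `H ^ n`. -/
noncomputable def vectorFunctional (v : PiLp 2 (fun _ : Fin n => H)) :
    Matrix (Fin n) (Fin n) E.toSubmodule →ₗ[ℂ] ℂ where
  toFun X := inner ℂ v (toOperator H (Fin n) (E.toCStarMatrix X) v)
  map_add' X Y := by
    rw [toCStarMatrix_add, map_add, _root_.add_apply, inner_add_right]
  map_smul' c X := by
    rw [toCStarMatrix_smul, map_smul, _root_.smul_apply, inner_smul_right]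
    rfl

lemma vectorFunctional_apply (v : PiLp 2 (fun _ : Fin n => H))
    (X : Matrix (Fin n) (Fin n) E.toSubmodule) :
    E.vectorFunctional v X = inner ℂ v (toOperator H (Fin n) (E.toCStarMatrix X) v) := rfl

lemma isQuasiState_vectorFunctional {v : PiLp 2 (fun _ : Fin n => H)} (hv : ‖v‖ ≤ 1) :
    E.IsQuasiState (E.vectorFunctional v) where
  map_star X := by
    rw [vectorFunctional_apply, vectorFunctional_apply, toCStarMatrix_conjTranspose, map_star,
      ContinuousLinearMap.star_eq_adjoint, ContinuousLinearMap.adjoint_inner_right]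
    exact (inner_conj_symm _ _).symm
  nonneg X hX := by
    have : 0 ≤ toOperator H (Fin n) (E.toCStarMatrix X) := map_nonneg _ hX
    exact ((ContinuousLinearMap.nonneg_iff_isPositive _).1 this).inner_nonneg_right v
  norm_le X := by
    rw [vectorFunctional_apply, matNorm,
      ← NonUnitalStarAlgHom.norm_map (toOperator H (Fin n)) toOperator_injective
        (E.toCStarMatrix X)]
    set T := toOperator H (Fin n) (E.toCStarMatrix X)
    calc ‖inner ℂ v (T v)‖ ≤ ‖v‖ * ‖T v‖ := norm_inner_le_norm _ _
      _ ≤ 1 * (‖T‖ * 1) := by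
        gcongr
        exact (T.le_opNorm v).trans (by gcongr)
      _ = ‖T‖ := by ring

lemma toOperator_one : toOperator H (Fin n) 1 = 1 := by
  ext v i
  rw [toOperator_apply, Finset.sum_eq_single i]
  · simp
  · intro j _ hj
    simp [CStarMatrix.one_apply_ne hj.symm]
  · simp

/-- Vector functionals at unit vectors are quasi-states and already detect positivity on `H ^ n`, so
no extension of functionals is needed. -/
lemma nonneg_add_smul_one_of_forall_quasiState {X : Matrix (Fin n) (Fin n) E.toSubmodule}
    (hX : X.IsHermitian) {t : ℝ}
    (h : ∀ φ : Matrix (Fin n) (Fin n) E.toSubmodule →ₗ[ℂ] ℂ, E.IsQuasiState φ → -t ≤ (φ X).re) :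
    0 ≤ E.toCStarMatrix X + (t : ℂ) • 1 := by
  refine (toOperator H (Fin n)).nonneg_of_map_nonneg toOperator_injective ?_
  rw [ContinuousLinearMap.nonneg_iff_isPositive, map_add, map_smul, toOperator_one]
  have hsa : IsSelfAdjoint (toOperator H (Fin n) (E.toCStarMatrix X)) :=
    (E.isSelfAdjoint_toCStarMatrix_iff.2 hX).map _
  have ht : IsSelfAdjoint ((t : ℂ) •
      (1 : PiLp 2 (fun _ : Fin n => H) →L[ℂ] PiLp 2 (fun _ : Fin n => H))) :=
    IsSelfAdjoint.smul (Complex.conj_ofReal t) (.one _)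
  rw [ContinuousLinearMap.isPositive_def]
  refine ⟨(hsa.add ht).isSymmetric, fun v => ?_⟩
  rcases eq_or_ne v 0 with rfl | hv
  · rw [ContinuousLinearMap.reApplyInnerSelf_apply, map_zero, inner_zero_left, map_zero]
  have hv' : 0 < ‖v‖ := norm_pos_iff.2 hv
  have := h _ (E.isQuasiState_vectorFunctional (v := (‖v‖⁻¹ : ℂ) • v)
    (by simp [norm_smul, hv'.ne']))
  rw [vectorFunctional_apply, map_smul, inner_smul_left, inner_smul_right, ← mul_assoc] at this
  set T := toOperator H (Fin n) (E.toCStarMatrix X)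
  have h2 : ((starRingEnd ℂ) (‖v‖⁻¹ : ℂ)) * (‖v‖⁻¹ : ℂ) = (((‖v‖ ^ 2)⁻¹ : ℝ) : ℂ) := by
    simp [sq]
  rw [h2, Complex.re_ofReal_mul, le_inv_mul_iff₀ (by positivity)] at this
  rw [ContinuousLinearMap.reApplyInnerSelf_apply, inner_re_symm]
  simp only [_root_.add_apply, _root_.smul_apply, inner_add_right,
    inner_smul_right, one_apply_eq_self, inner_self_eq_norm_sq_to_K]
  simp only [RCLike.re_to_complex, Complex.add_re]
  have h3 : ((t : ℂ) * ((‖v‖ : ℂ)) ^ 2).re = t * ‖v‖ ^ 2 := by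
    norm_cast
  refine le_of_le_of_eq ?_ (congrArg (_ + ·) h3.symm)
  linarith

end OperatorSystem

/-! ### Cones and norms of `E` read off from the order of `E^♯` -/

namespace OperatorSystem

variable {H : Type*} [NormedAddCommGroup H] [InnerProductSpace ℂ H] [CompleteSpace H]
  (E : OperatorSystem H) {n : ℕ}

open CStarMatrix

/-- The element `(x, A)` of `M_n(E^♯)`. -/
def sharpMk (x : Matrix (Fin n) (Fin n) E.toSubmodule) (A : Matrix (Fin n) (Fin n) ℂ) :
    Matrix (Fin n) (Fin n) E.Sharp :=
  Matrix.of fun i j => (x i j, A i j)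

lemma sharpMk_map_fst_map_snd (X : Matrix (Fin n) (Fin n) E.Sharp) :
    E.sharpMk (X.map Prod.fst) (X.map Prod.snd) = X := rfl

lemma isHermitian_sharpMk_iff {x : Matrix (Fin n) (Fin n) E.toSubmodule}
    {A : Matrix (Fin n) (Fin n) ℂ} :
    (E.sharpMk x A).IsHermitian ↔ x.IsHermitian ∧ A.IsHermitian := by
  simp only [Matrix.IsHermitian, ← Matrix.ext_iff, Prod.ext_iff, forall_and]
  rfl

lemma invSqrt_smul_one {c : ℝ} :
    invSqrt ((c : ℂ) • (1 : Matrix (Fin n) (Fin n) ℂ)) = (((√c)⁻¹ : ℝ) : ℂ) • 1 := by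
  have h (r : ℝ) : (r : ℂ) • (1 : Matrix (Fin n) (Fin n) ℂ) = algebraMap ℝ _ r := by
    rw [Algebra.algebraMap_eq_smul_one]
    exact Complex.coe_smul r _
  rw [invSqrt, h, h, cfc_algebraMap]

lemma scalarMulMul_smul_one (d : ℂ) (x : Matrix (Fin n) (Fin n) E.toSubmodule) :
    E.scalarMulMul (d • 1) x = d ^ 2 • x := by
  ext i j : 2
  simp only [scalarMulMul]
  rw [Finset.sum_eq_single i, Finset.sum_eq_single j]
  · simp [sq]
  · intro b _ hb
    simp [Matrix.one_apply_ne hb]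
  · simp
  · intro b _ hb
    simp [Matrix.one_apply_ne hb.symm]
  · simp

lemma scalarMulMul_invSqrt_smul_one {c : ℝ} (hc : 0 ≤ c)
    (x : Matrix (Fin n) (Fin n) E.toSubmodule) :
    E.scalarMulMul (invSqrt ((c : ℂ) • 1)) x = ((c⁻¹ : ℝ) : ℂ) • x := by
  rw [invSqrt_smul_one, scalarMulMul_smul_one, ← Complex.ofReal_pow, inv_pow, Real.sq_sqrt hc]

/-- For a scalar second component the conjugation is division by `t + ε`, and then `ε → 0`. The case
`t = 0` recovers the cones of `E`, the case `t = 1` its norms. -/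
lemma sharpMatPos_smul_one_iff {x : Matrix (Fin n) (Fin n) E.toSubmodule} {t : ℝ} (ht : 0 ≤ t) :
    E.SharpMatPos (E.sharpMk x ((t : ℂ) • 1)) ↔ x.IsHermitian ∧
      ∀ φ : Matrix (Fin n) (Fin n) E.toSubmodule →ₗ[ℂ] ℂ, E.IsQuasiState φ → -t ≤ (φ x).re := by
  have hpos : ((t : ℂ) • (1 : Matrix (Fin n) (Fin n) ℂ)).PosSemidef :=
    Matrix.PosSemidef.one.smul (by exact_mod_cast ht)
  have key (ε : ℝ) (hε : 0 < ε) (φ : Matrix (Fin n) (Fin n) E.toSubmodule →ₗ[ℂ] ℂ) :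
      -1 ≤ (φ (E.scalarMulMul (invSqrt ((t : ℂ) • 1 + (ε : ℂ) • 1)) x)).re ↔
        -(t + ε) ≤ (φ x).re := by
    rw [← add_smul, ← Complex.ofReal_add, E.scalarMulMul_invSqrt_smul_one (by positivity), map_smul,
      smul_eq_mul, Complex.re_ofReal_mul, le_inv_mul_iff₀ (by positivity)]
    simp
  have : E.SharpMatPos (E.sharpMk x ((t : ℂ) • 1)) ↔ (x.IsHermitian ∧
      ((t : ℂ) • (1 : Matrix (Fin n) (Fin n) ℂ)).IsHermitian) ∧
      ((t : ℂ) • (1 : Matrix (Fin n) (Fin n) ℂ)).PosSemidef ∧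
      ∀ ε : ℝ, 0 < ε → ∀ φ : Matrix (Fin n) (Fin n) E.toSubmodule →ₗ[ℂ] ℂ, E.IsQuasiState φ →
        -1 ≤ (φ (E.scalarMulMul (invSqrt ((t : ℂ) • 1 + (ε : ℂ) • 1)) x)).re := by
    rw [← isHermitian_sharpMk_iff]
    rfl
  rw [this]
  refine ⟨fun ⟨⟨hx, _⟩, _, h⟩ => ⟨hx, fun φ hφ => ?_⟩,
    fun ⟨hx, h⟩ => ⟨⟨hx, hpos.isHermitian⟩, hpos, fun ε hε φ hφ => ?_⟩⟩
  · refine le_of_forall_pos_le_add fun ε hε => ?_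
    have := (key ε hε φ).1 (h ε hε φ hφ)
    linarith
  · rw [key ε hε]
    have := h φ hφ
    linarith

lemma sharpMatPos_zero_iff {x : Matrix (Fin n) (Fin n) E.toSubmodule} :
    E.SharpMatPos (E.sharpMk x 0) ↔ E.MatPos x := by
  have h0 : (0 : Matrix (Fin n) (Fin n) ℂ) = ((0 : ℝ) : ℂ) • 1 := by simp
  rw [h0, E.sharpMatPos_smul_one_iff le_rfl, MatPos]
  refine ⟨fun ⟨hx, h⟩ => ?_, fun h => ⟨?_, fun φ hφ => ?_⟩⟩
  · simpa using E.nonneg_add_smul_one_of_forall_quasiState hx h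
  · exact E.isSelfAdjoint_toCStarMatrix_iff.1 (.of_nonneg h)
  · simpa using (Complex.nonneg_iff.1 (hφ.nonneg x h)).1

/-- The self-adjoint element of `M_{2n}(E)` with off-diagonal blocks `x` and `x⋆`. -/
noncomputable def offDiag (x : Matrix (Fin n) (Fin n) E.toSubmodule) :
    Matrix (Fin (n + n)) (Fin (n + n)) E.toSubmodule :=
  Matrix.reindex finSumFinEquiv finSumFinEquiv (Matrix.fromBlocks 0 x x.conjTranspose 0)

lemma toCStarMatrix_offDiag (x : Matrix (Fin n) (Fin n) E.toSubmodule) :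
    E.toCStarMatrix (E.offDiag x) = reindexₐ ℂ _ finSumFinEquiv
      (blocks 0 (E.toCStarMatrix x) (star (E.toCStarMatrix x)) 0) := by
  ext i j : 1
  change ((Matrix.fromBlocks 0 x x.conjTranspose 0 (finSumFinEquiv.symm i)
    (finSumFinEquiv.symm j) : E.toSubmodule) : H →L[ℂ] H) =
      Matrix.fromBlocks 0 (E.toCStarMatrix x) (star (E.toCStarMatrix x)) 0
        (finSumFinEquiv.symm i) (finSumFinEquiv.symm j)
  rcases finSumFinEquiv.symm i with i | i <;> rcases finSumFinEquiv.symm j with j | j <;> rfl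

/-- One direction is the Schur complement criterion in `M_{2n}(B(H))`; the other holds because
quasi-states are contractive and the off-diagonal matrix has norm at most `1`. -/
lemma sharpMatPos_offDiag_iff {x : Matrix (Fin n) (Fin n) E.toSubmodule} :
    E.SharpMatPos (E.sharpMk (E.offDiag x) 1) ↔ E.matNorm x ≤ 1 := by
  have h1 : (1 : Matrix (Fin (n + n)) (Fin (n + n)) ℂ) = ((1 : ℝ) : ℂ) • 1 := by simp
  rw [h1, E.sharpMatPos_smul_one_iff zero_le_one, matNorm]
  refine ⟨fun ⟨hx, h⟩ => ?_, fun h => ⟨?_, fun φ hφ => ?_⟩⟩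
  · have := E.nonneg_add_smul_one_of_forall_quasiState hx h
    rw [toCStarMatrix_offDiag, Complex.ofReal_one, one_smul,
      ← reindexₐ_one (m := Fin n ⊕ Fin n) finSumFinEquiv, ← map_add,
      reindexₐ_nonneg_iff, one_eq_blocks, blocks_add] at this
    rw [norm_le_one_iff_blocks_nonneg]
    simpa using this
  · rw [← isSelfAdjoint_toCStarMatrix_iff, toCStarMatrix_offDiag]
    refine IsSelfAdjoint.map ?_ _
    simp [isSelfAdjoint_iff, star_blocks]
  · have h2 : ‖φ (E.offDiag x)‖ ≤ 1 := by
      refine (hφ.norm_le _).trans ?_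
      rw [matNorm, toCStarMatrix_offDiag, norm_reindexₐ]
      exact norm_offDiag_le_one h
    exact (abs_le.1 ((Complex.abs_re_le_norm _).trans h2)).1

end OperatorSystem

/-! ### From `E^♯ ≅ B` to `E` -/

namespace OperatorSystem

open CStarMatrix

lemma matPos_const_iff {H : Type*} [NormedAddCommGroup H] [InnerProductSpace ℂ H] [CompleteSpace H]
    (E : OperatorSystem H) {x : E.toSubmodule} :
    E.MatPos (Matrix.of fun _ _ => x : Matrix (Fin 1) (Fin 1) E.toSubmodule) ↔
      0 ≤ (x : H →L[ℂ] H) :=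
  ofMatrix_const_nonneg_iff (n := Fin 1) (a := (x : H →L[ℂ] H))

lemma matNorm_const {H : Type*} [NormedAddCommGroup H] [InnerProductSpace ℂ H] [CompleteSpace H]
    (E : OperatorSystem H) (x : E.toSubmodule) :
    E.matNorm (Matrix.of fun _ _ => x : Matrix (Fin 1) (Fin 1) E.toSubmodule) = ‖x‖ :=
  norm_ofMatrix_const (n := Fin 1) (x : H →L[ℂ] H)

namespace SharpCStarIso

variable {H : Type*} [NormedAddCommGroup H] [InnerProductSpace ℂ H] [CompleteSpace H]
  {E : OperatorSystem H} {n : ℕ}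
  {B : Type*} [CStarAlgebra B] [PartialOrder B] [StarOrderedRing B] (Φ : E.SharpCStarIso B)

/-- The restriction of an isomorphism `E^♯ → B` to `E`. -/
noncomputable def incl : E.toSubmodule →ₗ[ℂ] B := Φ.toLinearEquiv.toLinearMap ∘ₗ LinearMap.inl ℂ _ _

lemma incl_apply (x : E.toSubmodule) : Φ.incl x = Φ.toLinearEquiv (x, 0) := rfl

lemma apply_eq (x : E.toSubmodule) (a : ℂ) : Φ.toLinearEquiv (x, a) = Φ.incl x + a • 1 := by
  have h1 : Φ.toLinearEquiv (0, 1) = 1 := Φ.map_one'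
  rw [incl_apply, ← h1, ← map_smul, ← map_add]
  simp

lemma incl_star (x : E.toSubmodule) : Φ.incl (star x) = star (Φ.incl x) := by
  have := Φ.map_star' (x, 0)
  rw [Prod.star_def, star_zero] at this
  exact this

lemma ofMatrix_map_incl_nonneg_iff {x : Matrix (Fin n) (Fin n) E.toSubmodule} :
    0 ≤ ofMatrix (x.map Φ.incl) ↔ E.MatPos x := by
  rw [← sharpMatPos_zero_iff, ← Φ.map_pos_iff']
  rfl

lemma ofMatrix_map_sharpMk_offDiag (x : Matrix (Fin n) (Fin n) E.toSubmodule) :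
    ofMatrix ((E.sharpMk (E.offDiag x) 1).map Φ.toLinearEquiv) = reindexₐ ℂ B finSumFinEquiv
      (blocks 1 (ofMatrix (x.map Φ.incl)) (star (ofMatrix (x.map Φ.incl))) 1) := by
  ext i j
  have h1 : (1 : Matrix (Fin (n + n)) (Fin (n + n)) ℂ) =
      Matrix.reindex finSumFinEquiv finSumFinEquiv (Matrix.fromBlocks 1 0 0 1) := by
    simp
  change Φ.toLinearEquiv ((Matrix.fromBlocks 0 x x.conjTranspose 0 (finSumFinEquiv.symm i)
    (finSumFinEquiv.symm j) : E.toSubmodule), (1 : Matrix (Fin (n + n)) (Fin (n + n)) ℂ) i j) =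
      Matrix.fromBlocks 1 (x.map Φ.incl) (x.map Φ.incl).conjTranspose 1
        (finSumFinEquiv.symm i) (finSumFinEquiv.symm j)
  rw [h1, Matrix.reindex_apply, Matrix.submatrix_apply, apply_eq]
  rcases finSumFinEquiv.symm i with i | i <;> rcases finSumFinEquiv.symm j with j | j <;>
    simp [Matrix.one_apply, incl_star]

lemma norm_ofMatrix_map_incl_le_one_iff {x : Matrix (Fin n) (Fin n) E.toSubmodule} :
    ‖ofMatrix (x.map Φ.incl)‖ ≤ 1 ↔ E.matNorm x ≤ 1 := by
  rw [norm_le_one_iff_blocks_nonneg, ← reindexₐ_nonneg_iff finSumFinEquiv,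
    ← ofMatrix_map_sharpMk_offDiag, ← sharpMatPos_offDiag_iff, ← Φ.map_pos_iff']
  rfl

lemma norm_ofMatrix_map_incl (x : Matrix (Fin n) (Fin n) E.toSubmodule) :
    ‖ofMatrix (x.map Φ.incl)‖ = E.matNorm x := by
  -- Rescaling carries the comparison of unit balls to every radius `r > 0`.
  have key (r : ℝ) (hr : 0 < r) : ‖ofMatrix (x.map Φ.incl)‖ ≤ r ↔ E.matNorm x ≤ r := by
    have := Φ.norm_ofMatrix_map_incl_le_one_iff (x := ((r⁻¹ : ℝ) : ℂ) • x)
    have h1 : ofMatrix ((((r⁻¹ : ℝ) : ℂ) • x).map Φ.incl) =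
        ((r⁻¹ : ℝ) : ℂ) • ofMatrix (x.map Φ.incl) := by
      ext i j
      exact map_smul Φ.incl _ _
    have h2 (y : ℝ) : r⁻¹ * y ≤ 1 ↔ y ≤ r := by rw [inv_mul_le_iff₀ hr, mul_one]
    rwa [h1, matNorm, toCStarMatrix_smul, norm_smul, norm_smul, Complex.norm_real,
      Real.norm_of_nonneg (inv_nonneg.2 hr.le), h2, h2] at this
  refine le_antisymm (le_of_forall_gt_imp_ge_of_dense fun r hr => ?_)
    (le_of_forall_gt_imp_ge_of_dense fun r hr => ?_)
  · exact (key r ((norm_nonneg _).trans_lt hr)).2 hr.le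
  · exact (key r ((norm_nonneg _).trans_lt hr)).1 hr.le

lemma norm_incl (x : E.toSubmodule) : ‖Φ.incl x‖ = ‖x‖ := by
  rw [← E.matNorm_const, ← Φ.norm_ofMatrix_map_incl]
  exact (norm_ofMatrix_const (n := Fin 1) (Φ.incl x)).symm

lemma incl_nonneg {x : E.toSubmodule} (hx : 0 ≤ (x : H →L[ℂ] H)) : 0 ≤ Φ.incl x := by
  rw [← E.matPos_const_iff, ← Φ.ofMatrix_map_incl_nonneg_iff] at hx
  exact ofMatrix_const_nonneg_iff.1 hx

/-- The extension `(x, a) ↦ a` of the zero map, as a positive functional on `B`. -/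
noncomputable def zeroState : B →ₚ[ℂ] ℂ :=
  PositiveLinearMap.mk₀ (LinearMap.snd ℂ _ _ ∘ₗ Φ.toLinearEquiv.symm.toLinearMap) fun b hb => by
    have h : 0 ≤ ofMatrix (Matrix.map (fun _ _ => Φ.toLinearEquiv.symm b :
        Matrix (Fin 1) (Fin 1) E.Sharp) Φ.toLinearEquiv) := by
      have : Matrix.map (fun _ _ => Φ.toLinearEquiv.symm b :
        Matrix (Fin 1) (Fin 1) E.Sharp) Φ.toLinearEquiv = fun _ _ => b := by
        ext
        simp [Matrix.map]
      rw [this]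
      exact ofMatrix_const_nonneg_iff.2 hb
    have := ((Φ.map_pos_iff' 1 _).1 h).2.1
    exact this.diag_nonneg (i := 0)

lemma zeroState_apply (x : E.toSubmodule) (a : ℂ) :
    Φ.zeroState (Φ.toLinearEquiv (x, a)) = a := by
  change (Φ.toLinearEquiv.symm (Φ.toLinearEquiv (x, a))).2 = a
  simp

/-- Cauchy–Schwarz for the form `(x, y) ↦ f (x⋆ y)`: with `p = s⋆ s`, the value `f (b p)` pairs `s
b⋆` with `s`, and `s` has seminorm zero. -/
lemma _root_.PositiveLinearMap.apply_mul_eq_zero {p : B} (f : B →ₚ[ℂ] ℂ) (hp : 0 ≤ p)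
    (hfp : f p = 0) (b : B) : f (b * p) = 0 := by
  obtain ⟨s, rfl⟩ := CStarAlgebra.nonneg_iff_eq_star_mul_self.1 hp
  have h := norm_inner_le_norm (𝕜 := ℂ) (f.toPreGNS (s * star b)) (f.toPreGNS s)
  rw [f.preGNS_norm_def (f.toPreGNS s), f.preGNS_inner_def] at h
  simp only [PositiveLinearMap.ofPreGNS_toPreGNS, hfp, star_mul, star_star] at h
  simpa [mul_assoc] using h

lemma zeroState_mul_incl (h : E.ApproxGeneratedByPositives) (b : B) (x : E.toSubmodule) :
    Φ.zeroState (b * Φ.incl x) = 0 := by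
  let f : E.toSubmodule →L[ℂ] ℂ :=
    { toLinearMap := Φ.zeroState.toLinearMap ∘ₗ LinearMap.mulLeft ℂ b ∘ₗ Φ.incl
      cont := by
        have h1 : Continuous Φ.incl := (AddMonoidHomClass.isometry_of_norm _ Φ.norm_incl).continuous
        exact (map_continuous Φ.zeroState).comp (continuous_const.mul h1) }
  -- The kernel of `x ↦ ω (b x)` is closed in `E` because `E → B` is isometric, and `E` is closed in
  -- `B(H)`; so it suffices to kill the positive elements.
  have hcl : IsClosed ((f.ker.map E.toSubmodule.subtype : Submodule ℂ (H →L[ℂ] H)) :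
      Set (H →L[ℂ] H)) := by
    rw [Submodule.map_coe]
    exact E.isClosed'.isClosedEmbedding_subtypeVal.isClosedMap _ f.isClosed_ker
  have hle : E.toSubmodule ≤ f.ker.map E.toSubmodule.subtype := by
    conv_lhs => rw [← show _ = E.toSubmodule from h]
    refine Submodule.topologicalClosure_minimal _ (Submodule.span_le.2 ?_) hcl
    rintro y ⟨hy, hy0⟩
    refine ⟨⟨y, hy⟩, ?_, rfl⟩
    exact Φ.zeroState.apply_mul_eq_zero (Φ.incl_nonneg (x := ⟨y, hy⟩) hy0)
      (Φ.zeroState_apply ⟨y, hy⟩ 0) b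
  obtain ⟨y, hy, hyx⟩ := hle x.2
  obtain rfl : y = x := Subtype.ext hyx
  exact hy

/-- Writing the right factor as `y + γ1` with `y ∈ E`, the term with `y` vanishes and the product
rule remains. -/
lemma zeroMapIsStarHom (h : E.ApproxGeneratedByPositives) : E.ZeroMapIsStarHom Φ := by
  have hone : Φ.zeroState 1 = 1 := by
    rw [← show Φ.toLinearEquiv (0, 1) = 1 from Φ.map_one', zeroState_apply]
  have hmul (b c : B) : Φ.zeroState (b * c) = Φ.zeroState b * Φ.zeroState c := by
    obtain ⟨⟨y, γ⟩, rfl⟩ := Φ.toLinearEquiv.surjective c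
    rw [zeroState_apply, apply_eq, mul_add, map_add, Φ.zeroState_mul_incl h, mul_smul_comm,
      mul_one, map_smul, zero_add, smul_eq_mul, mul_comm]
  let χ : B →⋆ₐ[ℂ] ℂ :=
    { AlgHom.ofLinearMap Φ.zeroState.toLinearMap hone hmul with
      map_star' := fun b => map_star Φ.zeroState b }
  refine ⟨χ, fun ⟨x, a⟩ => ?_⟩
  change Φ.zeroState _ = _
  rw [zeroState_apply]
  simp [sharpExtension]

end SharpCStarIso

section

variable {H : Type u} [NormedAddCommGroup H] [InnerProductSpace ℂ H] [CompleteSpace H]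
  {E : OperatorSystem H}

/-- The image of `E` in `B` is exactly the kernel of the character, a closed `⋆`-subalgebra, and `E
→ B` preserves all matrix norms and cones. -/
theorem isCStar_of_zeroMapIsStarHom {B : Type u} [CStarAlgebra B] [PartialOrder B]
    [StarOrderedRing B] (Φ : E.SharpCStarIso B) (h : E.ZeroMapIsStarHom Φ) : E.IsCStar := by
  obtain ⟨χ, hχ⟩ := h
  have hχ' (x : E.toSubmodule) (a : ℂ) : χ (Φ.toLinearEquiv (x, a)) = a := by
    rw [hχ]
    simp [sharpExtension]
  let S : NonUnitalStarSubalgebra ℂ B :=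
    { carrier := {b | χ b = 0}
      add_mem' := fun {a b} ha hb => by
        rw [Set.mem_ofPred_eq] at *
        rw [map_add, ha, hb, add_zero]
      zero_mem' := map_zero χ
      mul_mem' := fun {a b} ha hb => by
        rw [Set.mem_ofPred_eq] at *
        rw [map_mul, ha, zero_mul]
      smul_mem' := fun c {a} ha => by
        rw [Set.mem_ofPred_eq] at *
        rw [map_smul, ha, smul_zero]
      star_mem' := fun {a} ha => by
        rw [Set.mem_ofPred_eq] at *
        rw [map_star, ha, star_zero] }
  have hS : IsClosed (S : Set B) :=
    isClosed_eq (by open CStarAlgebra in exact map_continuous χ) continuous_const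
  let _ : NonUnitalCStarAlgebra S := NonUnitalStarSubalgebra.nonUnitalCStarAlgebra S
  let _ : PartialOrder S := CStarAlgebra.spectralOrder S
  have : StarOrderedRing S := CStarAlgebra.spectralOrderedRing S
  let ι : S →⋆ₙₐ[ℂ] B := NonUnitalStarSubalgebraClass.subtype S
  have hι : Function.Injective ι := Subtype.val_injective
  let e : E.toSubmodule ≃ₗ[ℂ] S :=
    { toFun := fun x => ⟨Φ.incl x, hχ' x 0⟩
      map_add' := fun x y => Subtype.ext (map_add Φ.incl x y)
      map_smul' := fun c x => Subtype.ext (map_smul Φ.incl c x)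
      invFun := fun s => (Φ.toLinearEquiv.symm s).1
      left_inv := fun x => by simp [SharpCStarIso.incl_apply]
      right_inv := fun s => by
        obtain ⟨⟨x, a⟩, hxa⟩ := Φ.toLinearEquiv.surjective (s : B)
        have ha : a = 0 := by
          rw [← hχ' x a, hxa]
          exact s.2
        apply Subtype.ext
        simp [SharpCStarIso.incl_apply, ← hxa, ha] }
  refine ⟨S, inferInstance, inferInstance, inferInstance, ⟨{ e with
    map_star' := fun x => Subtype.ext (Φ.incl_star x)
    map_pos_iff' := fun n X => ?_
    norm_map' := fun n X => ?_ }⟩⟩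
  · rw [← Φ.ofMatrix_map_incl_nonneg_iff]
    exact ((mapₙₐ (n := Fin n) ι).map_nonneg_iff (mapₙₐ_injective hι)).symm
  · rw [← Φ.norm_ofMatrix_map_incl]
    exact (NonUnitalStarAlgHom.norm_map (mapₙₐ (n := Fin n) ι) (mapₙₐ_injective hι) _).symm

end

end OperatorSystem

/-! ### Positive and negative parts, and the norm of the negative part -/

namespace CStarAlgebra

section

variable {D : Type*} [CStarAlgebra D] [PartialOrder D] [StarOrderedRing D]

lemma norm_negPart_le_one_of_nonneg_add_one {w : D} (hw : IsSelfAdjoint w) (h : 0 ≤ w + 1) :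
    ‖w⁻‖ ≤ 1 := by
  have h1 : algebraMap ℝ D (-1) ≤ w := by
    rw [map_neg, map_one]
    exact neg_le_iff_add_nonneg.2 h
  rw [CFC.negPart_def, cfcₙ_eq_cfc]
  refine norm_cfc_le zero_le_one fun x hx => ?_
  have := (algebraMap_le_iff_le_spectrum (a := w)).1 h1 x hx
  rw [Real.norm_eq_abs, abs_le]
  have h2 : 0 ≤ x⁻ := negPart_nonneg x
  have h3 : x⁻ ≤ 1 := by
    rw [negPart_def]
    exact max_le (by linarith) zero_le_one
  constructor <;> linarith

lemma nonneg_of_forall_pos_nonneg_add {w : D} (h : ∀ ε : ℝ, 0 < ε → 0 ≤ w + (ε : ℂ) • 1) :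
    0 ≤ w := by
  have h1 : Filter.Tendsto (fun ε : ℝ => w + (ε : ℂ) • (1 : D)) (nhdsWithin 0 (Set.Ioi 0))
      (nhds w) := by
    have : Continuous fun ε : ℝ => w + (ε : ℂ) • (1 : D) := by fun_prop
    have h2 := this.tendsto 0
    rw [Complex.ofReal_zero, zero_smul, add_zero] at h2
    exact h2.mono_left nhdsWithin_le_nhds
  refine (CStarAlgebra.isClosed_nonneg (A := D)).mem_of_tendsto h1 ?_
  filter_upwards [self_mem_nhdsWithin] with ε hε using h ε hε

/-- Substitute for orthogonality of `P` and `Q`: adding `t Q ≤ t P + t` to `t P + Q ≤ ‖Q‖` and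
cancelling `t P` gives `(1 + t) Q ≤ ‖Q‖ + t`, so `(1 + t) ‖Q‖ ≤ ‖Q‖ + t`. -/
lemma norm_le_one_of_norm_smul_add_le {P Q : D} (hQ : 0 ≤ Q) (h : 0 ≤ P - Q + 1) {t : ℝ}
    (hP : 0 ≤ P) (ht : 0 < t) (hPQ : ‖t • P + Q‖ ≤ ‖Q‖) : ‖Q‖ ≤ 1 := by
  have h1 : 0 ≤ t • P + Q := add_nonneg (smul_nonneg ht.le hP) hQ
  have h2 : t • P + Q ≤ algebraMap ℝ D ‖Q‖ :=
    (norm_le_iff_le_algebraMap _ (norm_nonneg Q) h1).1 hPQ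
  have h3 : 0 ≤ t • (P - Q + 1) := smul_nonneg ht.le h
  have h4 : (1 + t) • Q ≤ algebraMap ℝ D (‖Q‖ + t) := by
    have : (1 + t) • Q = t • P + Q + t • 1 - t • (P - Q + 1) := by module
    rw [this, map_add, Algebra.algebraMap_eq_smul_one t]
    exact (sub_le_self _ h3).trans (by gcongr)
  have h5 := (norm_le_iff_le_algebraMap ((1 + t) • Q) (by positivity)
    (smul_nonneg (by positivity) hQ)).2 h4
  rw [norm_smul, Real.norm_of_nonneg (by positivity)] at h5
  nlinarith

end

variable {C D : Type*} [NonUnitalCStarAlgebra C] [PartialOrder C] [StarOrderedRing C]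
  [CStarAlgebra D] [PartialOrder D] [StarOrderedRing D]

lemma exists_norm_smul_posPart_add_negPart_le {z : C} (hz : IsSelfAdjoint z) (hq : z⁻ ≠ 0) :
    ∃ t : ℝ, 0 < t ∧ ‖t • z⁺ + z⁻‖ ≤ ‖z⁻‖ := by
  have hz0 : z ≠ 0 := by
    rintro rfl
    simp at hq
  have hq' : 0 < ‖z⁻‖ := norm_pos_iff.2 hq
  have hz' : 0 < ‖z‖ := norm_pos_iff.2 hz0
  -- On the spectrum the positive part is at most `‖z‖`, so this `t` scales it below `‖z⁻‖`; the two
  -- parts have disjoint supports.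
  refine ⟨‖z⁻‖ / ‖z‖, by positivity, ?_⟩
  set t := ‖z⁻‖ / ‖z‖ with ht
  have h1 : t • z⁺ + z⁻ = cfcₙ (fun x : ℝ => t * x⁺ + x⁻) z := by
    rw [cfcₙ_add .., cfcₙ_const_mul .., CFC.posPart_def, CFC.negPart_def]
  rw [h1]
  refine norm_cfcₙ_le fun x hx => ?_
  have h2 : ‖x⁻‖ ≤ ‖z⁻‖ := norm_apply_le_norm_cfcₙ (·⁻ : ℝ → ℝ) z hx
  have h3 : ‖x‖ ≤ ‖z‖ := by
    simpa [cfcₙ_id' ℝ z] using norm_apply_le_norm_cfcₙ (fun x : ℝ => x) z hx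
  rcases le_total 0 x with h | h
  · rw [posPart_of_nonneg h, negPart_of_nonneg h, add_zero, norm_mul,
      Real.norm_of_nonneg (by positivity : 0 ≤ t)]
    calc t * ‖x‖ ≤ t * ‖z‖ := by gcongr
      _ = ‖z⁻‖ := by rw [ht]; field_simp
  · rwa [posPart_of_nonpos h, mul_zero, zero_add]

/-- Collects what is needed of the decomposition; what is said of `p` and `q` alone uses only linear
structure, norm and order, and so transfers along `E ≅ A`. -/
lemma exists_sub_and_nonneg_add_one_iff (φ : C →⋆ₙₐ[ℂ] D) (hφ : Function.Injective φ) {z : C}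
    (hz : IsSelfAdjoint z) :
    ∃ p q : C, 0 ≤ p ∧ 0 ≤ q ∧ z = p - q ∧ (0 ≤ φ z + 1 ↔ ‖q‖ ≤ 1) ∧
      (q ≠ 0 → ∃ t : ℝ, 0 < t ∧ ‖t • p + q‖ ≤ ‖q‖) := by
  refine ⟨z⁺, z⁻, CFC.posPart_nonneg z, CFC.negPart_nonneg z, (CFC.posPart_sub_negPart z hz).symm,
    ⟨fun h => ?_, fun h => ?_⟩, exists_norm_smul_posPart_add_negPart_le hz⟩
  · rw [← NonUnitalStarAlgHom.norm_map φ hφ, φ.map_negPart hz]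
    exact norm_negPart_le_one_of_nonneg_add_one (hz.map φ) h
  · have h1 : φ z⁻ ≤ 1 := by
      rw [← norm_le_one_iff_of_nonneg _ (map_nonneg φ (CFC.negPart_nonneg z)),
        NonUnitalStarAlgHom.norm_map φ hφ]
      exact h
    have h2 : φ z + 1 = φ z⁺ + (1 - φ z⁻) := by
      conv_lhs => rw [← CFC.posPart_sub_negPart z hz, map_sub]
      abel
    rw [h2]
    exact add_nonneg (map_nonneg φ (CFC.posPart_nonneg z)) (sub_nonneg.2 h1)

end CStarAlgebra

lemma OperatorSystem.exists_invSqrt_inverse {n : ℕ} {T : Matrix (Fin n) (Fin n) ℂ}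
    (hT : T.PosDef) : (invSqrt T).IsHermitian ∧ ∃ R : Matrix (Fin n) (Fin n) ℂ, R.IsHermitian ∧
      invSqrt T * R = 1 ∧ R * invSqrt T = 1 ∧ R * R = T := by
  have hsa : IsSelfAdjoint T := hT.isHermitian
  have hpos (x : ℝ) (hx : x ∈ spectrum ℝ T) : 0 < x := by
    rw [hT.isHermitian.spectrum_real_eq_range_eigenvalues] at hx
    obtain ⟨i, rfl⟩ := hx
    exact hT.eigenvalues_pos i
  -- The spectrum is finite, so the singularity of the inverse square root at `0` does no harm.
  have hc (f : ℝ → ℝ) : ContinuousOn f (spectrum ℝ T) :=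
    (Matrix.finite_real_spectrum (A := T)).continuousOn f
  refine ⟨cfc_predicate (p := IsSelfAdjoint) _ T, cfc Real.sqrt T,
    cfc_predicate (p := IsSelfAdjoint) _ T, ?_, ?_, ?_⟩
  · rw [invSqrt, ← cfc_mul _ _ T (hc _) (hc _), ← cfc_one ℝ T]
    refine cfc_congr fun x hx => ?_
    exact inv_mul_cancel₀ (Real.sqrt_pos.2 (hpos x hx)).ne'
  · rw [invSqrt, ← cfc_mul _ _ T (hc _) (hc _), ← cfc_one ℝ T]
    refine cfc_congr fun x hx => ?_
    exact mul_inv_cancel₀ (Real.sqrt_pos.2 (hpos x hx)).ne'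
  · rw [← cfc_mul _ _ T (hc _) (hc _)]
    conv_rhs => rw [← cfc_id' ℝ T]
    refine cfc_congr fun x hx => ?_
    exact Real.mul_self_sqrt (hpos x hx).le

/-! ### From `E ≅ A` to `E^♯`: the order of the unitization -/

namespace OperatorSystem

open CStarMatrix

lemma _root_.CStarMatrix.exists_sub_and_nonneg_add_one_iff {A B : Type*} [NonUnitalCStarAlgebra A]
    [PartialOrder A] [StarOrderedRing A] [CStarAlgebra B] [PartialOrder B] [StarOrderedRing B]
    {n : ℕ} (φ : A →⋆ₙₐ[ℂ] B) (hφ : Function.Injective φ) {z : CStarMatrix (Fin n) (Fin n) A}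
    (hz : IsSelfAdjoint z) :
    ∃ p q : CStarMatrix (Fin n) (Fin n) A, 0 ≤ p ∧ 0 ≤ q ∧ z = p - q ∧
      (0 ≤ mapₙₐ φ z + 1 ↔ ‖q‖ ≤ 1) ∧ (q ≠ 0 → ∃ t : ℝ, 0 < t ∧ ‖(t : ℂ) • p + q‖ ≤ ‖q‖) := by
  obtain ⟨p, q, hp, hq, hpq, h1, h2⟩ :=
    CStarAlgebra.exists_sub_and_nonneg_add_one_iff (mapₙₐ (n := Fin n) φ) (mapₙₐ_injective hφ) hz
  exact ⟨p, q, hp, hq, hpq, h1, h2⟩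

namespace CStarIso

variable {H : Type*} [NormedAddCommGroup H] [InnerProductSpace ℂ H] [CompleteSpace H]
  {E : OperatorSystem H} {n : ℕ}
  {A : Type*} [NonUnitalCStarAlgebra A] [PartialOrder A] [StarOrderedRing A] (ι : E.CStarIso A)

/-- The amplification `M_n(E) → M_n(A)`. -/
def mapMatrix (X : Matrix (Fin n) (Fin n) E.toSubmodule) : CStarMatrix (Fin n) (Fin n) A :=
  ofMatrix (X.map ι.toLinearEquiv)

lemma mapMatrix_add (X Y : Matrix (Fin n) (Fin n) E.toSubmodule) :
    ι.mapMatrix (X + Y) = ι.mapMatrix X + ι.mapMatrix Y := by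
  ext i j
  exact map_add ι.toLinearEquiv _ _

lemma mapMatrix_sub (X Y : Matrix (Fin n) (Fin n) E.toSubmodule) :
    ι.mapMatrix (X - Y) = ι.mapMatrix X - ι.mapMatrix Y := by
  ext i j
  exact map_sub ι.toLinearEquiv _ _

lemma mapMatrix_smul (c : ℂ) (X : Matrix (Fin n) (Fin n) E.toSubmodule) :
    ι.mapMatrix (c • X) = c • ι.mapMatrix X := by
  ext i j
  exact map_smul ι.toLinearEquiv _ _

lemma map_star (x : E.toSubmodule) : ι.toLinearEquiv (star x) = star (ι.toLinearEquiv x) :=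
  ι.map_star' x

lemma mapMatrix_conjTranspose (X : Matrix (Fin n) (Fin n) E.toSubmodule) :
    ι.mapMatrix X.conjTranspose = star (ι.mapMatrix X) := by
  ext i j
  exact ι.map_star _

lemma mapMatrix_injective : Function.Injective (ι.mapMatrix (n := n)) := by
  intro X Y h
  ext i j : 2
  exact congrArg Subtype.val (ι.toLinearEquiv.injective (congrFun (congrFun h i) j))

lemma mapMatrix_surjective : Function.Surjective (ι.mapMatrix (n := n)) := by
  intro a
  refine ⟨Matrix.of fun i j => ι.toLinearEquiv.symm (a i j), ?_⟩
  ext i j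
  exact ι.toLinearEquiv.apply_symm_apply _

lemma isSelfAdjoint_mapMatrix_iff {X : Matrix (Fin n) (Fin n) E.toSubmodule} :
    IsSelfAdjoint (ι.mapMatrix X) ↔ X.IsHermitian := by
  rw [isSelfAdjoint_iff, ← mapMatrix_conjTranspose, ι.mapMatrix_injective.eq_iff]
  rfl

lemma mapMatrix_nonneg_iff {X : Matrix (Fin n) (Fin n) E.toSubmodule} :
    0 ≤ ι.mapMatrix X ↔ E.MatPos X := ι.map_pos_iff' n X

lemma norm_mapMatrix (X : Matrix (Fin n) (Fin n) E.toSubmodule) :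
    ‖ι.mapMatrix X‖ = E.matNorm X := ι.norm_map' n X

/-- Both sides amount to `‖q‖ ≤ 1` for the negative part `q` taken in `M_n(A)`. A quasi-state is at
least `-‖q‖` on `p - q`. -/
lemma nonneg_add_one_iff_forall_quasiState {B : Type*} [CStarAlgebra B] [PartialOrder B]
    [StarOrderedRing B] (φ : A →⋆ₙₐ[ℂ] B) (hφ : Function.Injective φ)
    {Z : Matrix (Fin n) (Fin n) E.toSubmodule} (hZ : Z.IsHermitian) :
    0 ≤ mapₙₐ φ (ι.mapMatrix Z) + 1 ↔
      ∀ ψ : Matrix (Fin n) (Fin n) E.toSubmodule →ₗ[ℂ] ℂ, E.IsQuasiState ψ → -1 ≤ (ψ Z).re := by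
  obtain ⟨p, q, hp, hq, hpq, h1, h2⟩ :=
    exists_sub_and_nonneg_add_one_iff φ hφ (ι.isSelfAdjoint_mapMatrix_iff.2 hZ)
  obtain ⟨P, rfl⟩ := ι.mapMatrix_surjective p
  obtain ⟨Q, rfl⟩ := ι.mapMatrix_surjective q
  rw [← mapMatrix_sub, ι.mapMatrix_injective.eq_iff] at hpq
  rw [h1]
  rw [mapMatrix_nonneg_iff] at hp hq
  refine ⟨fun h ψ hψ => ?_, fun h => ?_⟩
  · have h3 : ‖ψ Q‖ ≤ 1 := (hψ.norm_le Q).trans (by rwa [← ι.norm_mapMatrix])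
    have h4 := (Complex.nonneg_iff.1 (hψ.nonneg P hp)).1
    have h5 := (abs_le.1 ((Complex.abs_re_le_norm _).trans h3)).2
    rw [hpq, map_sub, Complex.sub_re]
    linarith
  · by_cases hQ : ι.mapMatrix Q = 0
    · exact (norm_eq_zero.2 hQ).trans_le zero_le_one
    obtain ⟨t, ht, htq⟩ := h2 hQ
    rw [← mapMatrix_smul, ← mapMatrix_add, norm_mapMatrix, norm_mapMatrix] at htq
    rw [norm_mapMatrix]
    -- The argument moves to `M_n(B(H))`, where `P` and `Q` are still positive but possibly not
    -- orthogonal.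
    have h3 := E.nonneg_add_smul_one_of_forall_quasiState hZ h
    rw [Complex.ofReal_one, one_smul, hpq] at h3
    exact CStarAlgebra.norm_le_one_of_norm_smul_add_le (P := E.toCStarMatrix P)
      (Q := E.toCStarMatrix Q) hq h3 hp ht htq

/-- The extension `E^♯ → A ⊕ ℂ` of an isomorphism `E → A`. -/
noncomputable def unitizationEquiv : E.Sharp ≃ₗ[ℂ] Unitization ℂ A where
  toFun v := Unitization.inl v.2 + (ι.toLinearEquiv v.1 : Unitization ℂ A)
  map_add' v w := by
    ext <;> simp
  map_smul' c v := by
    ext <;> simp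
  invFun u := (ι.toLinearEquiv.symm u.snd, u.fst)
  left_inv v := by simp
  right_inv u := by ext <;> simp

variable (A) in
/-- The unit inclusion `ℂ → A ⊕ ℂ`. -/
noncomputable def scalarHom : ℂ →⋆ₙₐ[ℂ] Unitization ℂ A :=
  (StarAlgHom.ofId ℂ (Unitization ℂ A) : ℂ →⋆ₙₐ[ℂ] Unitization ℂ A)

lemma scalarHom_apply (c : ℂ) : scalarHom A c = Unitization.inl c := rfl

variable [PartialOrder (Unitization ℂ A)] [StarOrderedRing (Unitization ℂ A)]

lemma ofMatrix_map_unitizationEquiv (x : Matrix (Fin n) (Fin n) E.toSubmodule)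
    (a : Matrix (Fin n) (Fin n) ℂ) :
    ofMatrix ((E.sharpMk x a).map ι.unitizationEquiv) =
      mapₙₐ (scalarHom A) (ofMatrix a) +
        mapₙₐ (Unitization.inrNonUnitalStarAlgHom ℂ A) (ι.mapMatrix x) := rfl

lemma mapₙₐ_scalarHom_one :
    mapₙₐ (scalarHom A) (1 : CStarMatrix (Fin n) (Fin n) ℂ) = 1 := by
  ext i j : 1
  by_cases h : i = j
  · subst h
    simp [scalarHom_apply]
  · simp [CStarMatrix.one_apply_ne h, scalarHom_apply]

lemma mapMatrix_scalarMulMul (C : Matrix (Fin n) (Fin n) ℂ)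
    (x : Matrix (Fin n) (Fin n) E.toSubmodule) :
    mapₙₐ (scalarHom A) (ofMatrix C) *
        mapₙₐ (Unitization.inrNonUnitalStarAlgHom ℂ A) (ι.mapMatrix x) *
        mapₙₐ (scalarHom A) (ofMatrix C) =
      mapₙₐ (Unitization.inrNonUnitalStarAlgHom ℂ A) (ι.mapMatrix (E.scalarMulMul C x)) := by
  ext i j : 1
  simp only [mul_apply, mapₙₐ_apply, mapₗ_apply, CStarMatrix.map_apply, mapMatrix, scalarMulMul,
    ofMatrix_apply, Matrix.map_apply, map_sum, map_smul, Finset.sum_mul]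
  rw [Finset.sum_comm]
  refine Finset.sum_congr rfl fun k _ => Finset.sum_congr rfl fun l _ => ?_
  change Unitization.inl (C i k) * (ι.toLinearEquiv (x k l) : Unitization ℂ A) *
    Unitization.inl (C l j) = (C i k * C l j) • (ι.toLinearEquiv (x k l) : Unitization ℂ A)
  rw [Unitization.inl_mul_inr, Unitization.inr_mul_inl, smul_smul, mul_comm, Unitization.inr_smul]

lemma isSelfAdjoint_mapₙₐ_scalarHom {C : Matrix (Fin n) (Fin n) ℂ} (hC : C.IsHermitian) :
    IsSelfAdjoint (mapₙₐ (scalarHom A) (ofMatrix C)) :=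
  IsSelfAdjoint.map (x := (ofMatrix C : CStarMatrix (Fin n) (Fin n) ℂ)) hC _

lemma isHermitian_scalarMulMul (ι : E.CStarIso A) {C : Matrix (Fin n) (Fin n) ℂ}
    (hC : C.IsHermitian)
    {x : Matrix (Fin n) (Fin n) E.toSubmodule} (hx : x.IsHermitian) :
    (E.scalarMulMul C x).IsHermitian := by
  rw [← ι.isSelfAdjoint_mapMatrix_iff]
  apply mapₙₐ_injective (f := Unitization.inrNonUnitalStarAlgHom ℂ A) Unitization.inr_injective
  rw [StarHomClass.map_star]
  refine IsSelfAdjoint.star_eq ?_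
  rw [← mapMatrix_scalarMulMul]
  exact ((ι.isSelfAdjoint_mapMatrix_iff.2 hx).map _).conjugate_self
    (isSelfAdjoint_mapₙₐ_scalarHom hC)

/-- Conjugating by `T^(-1/2)`, and back by `R = T^(1/2)`, exchanges `T + x` with `1 + T^(-1/2) x
T^(-1/2)`. -/
lemma nonneg_iff_forall_quasiState_of_posDef {T : Matrix (Fin n) (Fin n) ℂ} (hT : T.PosDef)
    {x : Matrix (Fin n) (Fin n) E.toSubmodule} (hx : x.IsHermitian) :
    0 ≤ mapₙₐ (scalarHom A) (ofMatrix T) +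
        mapₙₐ (Unitization.inrNonUnitalStarAlgHom ℂ A) (ι.mapMatrix x) ↔
      ∀ ψ : Matrix (Fin n) (Fin n) E.toSubmodule →ₗ[ℂ] ℂ, E.IsQuasiState ψ →
        -1 ≤ (ψ (E.scalarMulMul (invSqrt T) x)).re := by
  obtain ⟨hC, R, hR, hCR, hRC, hRR⟩ := exists_invSqrt_inverse hT
  rw [← ι.nonneg_add_one_iff_forall_quasiState (Unitization.inrNonUnitalStarAlgHom ℂ A)
    Unitization.inr_injective (ι.isHermitian_scalarMulMul hC hx), ← mapMatrix_scalarMulMul]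
  have hC' := isSelfAdjoint_mapₙₐ_scalarHom (A := A) hC
  have hR' := isSelfAdjoint_mapₙₐ_scalarHom (A := A) hR
  have h1 : mapₙₐ (scalarHom A) (ofMatrix (invSqrt T)) * mapₙₐ (scalarHom A) (ofMatrix R) = 1 := by
    rw [← map_mul, ← mapₙₐ_scalarHom_one]
    exact congrArg _ hCR
  have h2 : mapₙₐ (scalarHom A) (ofMatrix R) * mapₙₐ (scalarHom A) (ofMatrix (invSqrt T)) = 1 := by
    rw [← map_mul, ← mapₙₐ_scalarHom_one]
    exact congrArg _ hRC
  have h3 : mapₙₐ (scalarHom A) (ofMatrix T) =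
      mapₙₐ (scalarHom A) (ofMatrix R) * mapₙₐ (scalarHom A) (ofMatrix R) := by
    rw [← map_mul]
    exact congrArg _ hRR.symm
  rw [h3]
  generalize mapₙₐ (scalarHom A) (ofMatrix (invSqrt T)) = c at *
  generalize mapₙₐ (scalarHom A) (ofMatrix R) = r at *
  generalize mapₙₐ (Unitization.inrNonUnitalStarAlgHom ℂ A) (ι.mapMatrix x) = y at *
  constructor <;> intro h
  · have := hC'.conjugate_nonneg h
    rwa [mul_add, add_mul, ← mul_assoc c r r, h1, one_mul, h2, add_comm] at this
  · have := hR'.conjugate_nonneg h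
    rwa [mul_add, add_mul, mul_one, mul_assoc c, ← mul_assoc r c, h2, one_mul, mul_assoc y, h1,
      mul_one, add_comm] at this

lemma posSemidef_of_nonneg {x : Matrix (Fin n) (Fin n) E.toSubmodule}
    {a : Matrix (Fin n) (Fin n) ℂ} (h : 0 ≤ ofMatrix ((E.sharpMk x a).map ι.unitizationEquiv)) :
    a.PosSemidef := by
  -- The scalar part is a character of the unitization; its amplification sends `(x, a)` to `a` and
  -- preserves positivity.
  let χ : Unitization ℂ A →⋆ₙₐ[ℂ] ℂ :=
    { toFun := fun u => u.fst
      map_smul' := fun c u => Unitization.fst_smul c u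
      map_zero' := Unitization.fst_zero
      map_add' := fun u v => Unitization.fst_add u v
      map_mul' := fun u v => Unitization.fst_mul u v
      map_star' := fun u => Unitization.fst_star u }
  have h1 : mapₙₐ χ (ofMatrix ((E.sharpMk x a).map ι.unitizationEquiv)) = ofMatrix a := by
    ext i j
    exact add_zero (a i j)
  have h2 : 0 ≤ mapₙₐ χ (ofMatrix ((E.sharpMk x a).map ι.unitizationEquiv)) := map_nonneg _ h
  rw [h1] at h2
  obtain ⟨s, hs⟩ := exists_eq_star_mul_self_of_nonneg h2
  have : a = (ofMatrix.symm s).conjTranspose * ofMatrix.symm s := hs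
  rw [this]
  exact Matrix.posSemidef_conjTranspose_mul_self _

lemma ofMatrix_map_unitizationEquiv_nonneg_iff (X : Matrix (Fin n) (Fin n) E.Sharp) :
    0 ≤ ofMatrix (X.map ι.unitizationEquiv) ↔ E.SharpMatPos X := by
  obtain ⟨x, a, rfl⟩ : ∃ x a, X = E.sharpMk x a :=
    ⟨_, _, (E.sharpMk_map_fst_map_snd X).symm⟩
  have hd (h : a.PosSemidef) (ε : ℝ) (hε : 0 < ε) : (a + (ε : ℂ) • 1).PosDef :=
    Matrix.PosDef.posSemidef_add h (Matrix.PosDef.one.smul (by exact_mod_cast hε))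
  have key (hx : x.IsHermitian) (h : a.PosSemidef) (ε : ℝ) (hε : 0 < ε) :
      0 ≤ ofMatrix ((E.sharpMk x a).map ι.unitizationEquiv) + (ε : ℂ) • 1 ↔
        ∀ ψ : Matrix (Fin n) (Fin n) E.toSubmodule →ₗ[ℂ] ℂ, E.IsQuasiState ψ →
        -1 ≤ (ψ (E.scalarMulMul (invSqrt (a + (ε : ℂ) • 1)) x)).re := by
    rw [← ι.nonneg_iff_forall_quasiState_of_posDef (hd h ε hε) hx, ofMatrix_map_unitizationEquiv,
      ← mapₙₐ_scalarHom_one, ← map_smul, add_right_comm, ← map_add]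
    rfl
  constructor
  · intro h
    have h1 := ι.posSemidef_of_nonneg h
    have h2 : x.IsHermitian := by
      rw [← ι.isSelfAdjoint_mapMatrix_iff]
      apply mapₙₐ_injective (f := Unitization.inrNonUnitalStarAlgHom ℂ A) Unitization.inr_injective
      rw [StarHomClass.map_star]
      refine IsSelfAdjoint.star_eq ?_
      have h3 := (IsSelfAdjoint.of_nonneg h).sub
        (isSelfAdjoint_mapₙₐ_scalarHom (A := A) h1.isHermitian)
      rwa [ofMatrix_map_unitizationEquiv, add_sub_cancel_left] at h3
    refine ⟨isHermitian_sharpMk_iff E |>.2 ⟨h2, h1.isHermitian⟩, h1, fun ε hε => ?_⟩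
    exact (key h2 h1 ε hε).1 (add_nonneg h (smul_nonneg (by exact_mod_cast hε.le) zero_le_one))
  · rintro ⟨h1, h2, h3⟩
    have h4 := (isHermitian_sharpMk_iff E).1 h1
    -- The matrix `a` may be singular: each `a + ε` is positive definite, and the cone is closed
    -- under `ε → 0`.
    exact CStarAlgebra.nonneg_of_forall_pos_nonneg_add fun ε hε => (key h4.1 h2 ε hε).2 (h3 ε hε)

end CStarIso

end OperatorSystem

/-! ### The implications -/

namespace OperatorSystem

variable {H : Type u} [NormedAddCommGroup H] [InnerProductSpace ℂ H] [CompleteSpace H]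
  {E : OperatorSystem H}

theorem IsCStar.sharpIsCStar (h : E.IsCStar) : E.SharpIsCStar := by
  obtain ⟨A, _, _, _, ⟨ι⟩⟩ := h
  let _ : PartialOrder (Unitization ℂ A) := CStarAlgebra.spectralOrder _
  have : StarOrderedRing (Unitization ℂ A) := CStarAlgebra.spectralOrderedRing _
  refine ⟨Unitization ℂ A, inferInstance, inferInstance, inferInstance,
    ⟨{ ι.unitizationEquiv with
      map_one' := ?_
      map_star' := fun v => ?_
      map_pos_iff' := fun n X => ι.ofMatrix_map_unitizationEquiv_nonneg_iff X }⟩⟩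
  · change Unitization.inl 1 + (ι.toLinearEquiv 0 : Unitization ℂ A) = 1
    simp
  · change Unitization.inl (star v.2) + (ι.toLinearEquiv (star v.1) : Unitization ℂ A) =
      star (Unitization.inl v.2 + (ι.toLinearEquiv v.1 : Unitization ℂ A))
    rw [ι.map_star, star_add, Unitization.inl_star, Unitization.inr_star]

/-- Every C⋆-algebra is spanned by its positive elements, and `1 × 1` matrices carry their
positivity back to `E`. -/
theorem IsCStar.generatedByPositives (h : E.IsCStar) : E.GeneratedByPositives := by
  obtain ⟨A, _, _, _, ⟨ι⟩⟩ := h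
  refine le_antisymm (Submodule.span_le.2 fun x hx => hx.1) fun x hx => ?_
  have h1 : ι.toLinearEquiv ⟨x, hx⟩ ∈ Submodule.span ℂ {a : A | 0 ≤ a} := by
    rw [CStarAlgebra.span_nonneg]
    trivial
  have h2 := Submodule.mem_map_of_mem (f := E.toSubmodule.subtype ∘ₗ
    ι.toLinearEquiv.symm.toLinearMap) h1
  rw [Submodule.map_span] at h2
  simp only [LinearMap.comp_apply, LinearEquiv.coe_coe, LinearEquiv.symm_apply_apply,
    Submodule.subtype_apply] at h2
  refine Submodule.span_mono ?_ h2
  rintro _ ⟨a, ha, rfl⟩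
  refine ⟨(ι.toLinearEquiv.symm a).2, ?_⟩
  refine E.matPos_const_iff.1 (ι.mapMatrix_nonneg_iff.1 ?_)
  have h3 : ι.mapMatrix (Matrix.of fun _ _ => ι.toLinearEquiv.symm a :
      Matrix (Fin 1) (Fin 1) E.toSubmodule) = CStarMatrix.ofMatrix fun _ _ => a := by
    ext i j
    exact ι.toLinearEquiv.apply_symm_apply a
  exact (CStarMatrix.ofMatrix_const_nonneg_iff.2 ha).trans_eq h3.symm

theorem GeneratedByPositives.approxGeneratedByPositives (h : E.GeneratedByPositives) :
    E.ApproxGeneratedByPositives := by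
  rw [ApproxGeneratedByPositives, show Submodule.span ℂ E.posElements = E.toSubmodule from h]
  exact IsClosed.submodule_topologicalClosure_eq E.isClosed'

end OperatorSystem

theorem mainTheorem4 {H : Type u} [NormedAddCommGroup H] [InnerProductSpace ℂ H] [CompleteSpace H]
    (E : OperatorSystem H) :
    List.TFAE [
      E.IsCStar,
      E.SharpIsCStar ∧ E.GeneratedByPositives,
      E.SharpIsCStar ∧ E.ApproxGeneratedByPositives,
      ∃ (B : Type u) (_ : CStarAlgebra B) (_ : PartialOrder B) (_ : StarOrderedRing B)
        (Φ : E.SharpCStarIso B), E.ZeroMapIsStarHom Φ,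
      E.SharpIsCStar ∧
        ∀ (B : Type u) [CStarAlgebra B] [PartialOrder B] [StarOrderedRing B]
          (Φ : E.SharpCStarIso B), E.ZeroMapIsStarHom Φ] := by
  tfae_have 1 → 2 := fun h => ⟨h.sharpIsCStar, h.generatedByPositives⟩
  tfae_have 2 → 3 := fun h => ⟨h.1, h.2.approxGeneratedByPositives⟩
  tfae_have 3 → 5 := fun h => ⟨h.1, fun B _ _ _ Φ => Φ.zeroMapIsStarHom h.2⟩
  tfae_have 5 → 4 := by
    rintro ⟨⟨B, _, _, _, ⟨Φ⟩⟩, h⟩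
    exact ⟨B, _, _, _, Φ, h B Φ⟩
  tfae_have 4 → 1 := by
    rintro ⟨B, _, _, _, Φ, h⟩
    exact OperatorSystem.isCStar_of_zeroMapIsStarHom Φ h
  tfae_finish
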